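/- **Lemma 4.4.** Let $p>0$ and $q$ be coprime integers with $q$ odd and $|q|<p$. For $i\in\mathbb Z$ put $\epsilon_i=(-1)^{\lfloor iq/p\rfloor}$, and let $$w=a^{\epsilon_0}b^{\epsilon_1}a^{\epsilon_2}b^{\epsilon_3}\cdots a^{\epsilon_{2p-2}}b^{\epsilon_{2p-1}}$$ be the relator of the presentation $\langle a,b\mid w\rangle$ of the group of the two-bridge link $L(p/q)$. Let $R_0$ be the word obtained from $w$ by Reidemeister–Schreier rewriting with coset representatives $a^k$ ($k\in\mathbb Z$) and generators $S_k=a^kba^{-k-1}$: the letters $a^{\pm1}$ are deleted, a letter $b$ that is preceded in $w$ by a prefix of exponent sum $k$ becomes $S_k$, and a letter $b^{-1}$ that is preceded by a prefix of exponent sum $k$ becomes $S_{k-1}^{-1}$. Let $M$ and $m$ be the largest and the smallest subscript of the letters $S_k^{\pm1}$ appearing in $R_0$. For a word $W$ in the letters $S_k^{\pm1}$, let $[W]$ be its class in the free abelian group on $\{S_k\}_{k\in\mathbb Z}$, and put $S'_k=[S_k]$. Then there are a positive integer $N$ and positive integers $n_1,\dots,n_N$ such that both of the following hold. (Top.) There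 are words $\widehat A_0,\dots,\widehat A_N$ and $\widehat V_1,\dots,\widehat V_N$ in the $S_k^{\pm1}$ such that 1. $\widehat A_0=R_0$; 2. $\widehat A_N=S_M$ or $\widehat A_N=S_M^{-1}$; 3. for each $i=1,\dots,N$, $\widehat A_{i-1}$ is conjugate to $\widehat A_i^{\,n_i}\widehat V_i$ in the free group on $\{S_k\}_{k\in\mathbb Z}$; 4. for each $i=1,\dots,N$, neither $S_M$ nor $S_M^{-1}$ appears in $\widehat V_i$; 5. for each $i=1,\dots,N$ there are an integer $l$ with $m<l\le M$ and integers $b_l,\dots,b_M$ (depending on $i$) such that $[\widehat A_i]=\sum_{j=l}^{M}b_jS'_j$ and $|b_{l+j}|=|b_{M-j}|$ for all $0\le j\le M-l$. (Bottom.) With the same $N$ and the same $n_1,\dots,n_N$, there are words $\check A_0,\dots,\check A_N$ and $\check V_1,\dots,\check V_N$ in the $S_k^{\pm1}$ such that 1. $\check A_0=R_0$; 2. $\check A_N=S_m$ or $\check A_N=S_m^{-1}$; 3. for each $i=1,\dots,N$, $\check A_{i-1}$ is conjugate to $\check A_i^{\,n_i}\check V_i$ in the free group on $\{S_k\}_{k\in\mathbb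 Z}$; 4. for each $i=1,\dots,N$, neither $S_m$ nor $S_m^{-1}$ appears in $\check V_i$; 5. for each $i=1,\dots,N$ there are an integer $l'$ with $m\le l'<M$ and integers $b_m,\dots,b_{l'}$ (depending on $i$) such that $[\check A_i]=\sum_{j=m}^{l'}b_jS'_j$ and $|b_{m+j}|=|b_{l'-j}|$ for all $0\le j\le l'-m$. -/

import Mathlib

namespace TwoBridge

/-- A (not necessarily reduced) word in the letters `x` and `x⁻¹`, `x : α`. The letter `x` is
`(x, true)` and the letter `x⁻¹` is `(x, false)`, as for `FreeGroup.mk`, which sends a word to the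
element of the free group that it represents. -/
abbrev Word (α : Type) : Type := List (α × Bool)

/-- The two generators of the link group of a two-bridge link. -/
inductive Gen : Type
  | a
  | b


/-- The sign `ε_i = (-1)^⌊iq/p⌋`; integer division by a positive number is the floor of the
quotient. -/
def epsilon (p : ℕ) (q : ℤ) (i : ℤ) : ℤˣ := Int.negOnePow (i * q / (p : ℤ))

/-- The relator `w = a^{ε_0} b^{ε_1} a^{ε_2} b^{ε_3} ⋯ a^{ε_{2p-2}} b^{ε_{2p-1}}` of the presentation
`⟨a, b | w⟩` of the link group of `L(p/q)`. -/
def relator (p : ℕ) (q : ℤ) : Word Gen :=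
  (List.range (2 * p)).map fun i =>
    (if Even i then Gen.a else Gen.b, decide (epsilon p q (i : ℤ) = 1))

/-- The Reidemeister–Schreier symbol `γ(a^k, x) = a^k x (rep (a^k x))⁻¹`, where the representative of
the coset of a word is `a^s`, `s` being its exponent sum. It is trivial for `x = a`, and it is the
generator `S_k = a^k b a^{-k-1}` for `x = b`. The generator `S_k` is encoded by the integer `k`. -/
def gamma (k : ℤ) : Gen → Word ℤ
  | Gen.a => []
  | Gen.b => [(k, true)]

/-- The Reidemeister–Schreier rewriting of a word `u` in `a`, `b` that is read after a prefix with
exponent sum `k`: a letter `x` gives `γ(rep t, x)` with `t` the prefix before `x`, and a letter `x⁻¹`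
gives `γ(rep t, x)⁻¹` with `t` the prefix up to and including `x⁻¹`. -/
def tauFrom : ℤ → Word Gen → Word ℤ
  | _, [] => []
  | k, (x, true) :: u => gamma k x ++ tauFrom (k + 1) u
  | k, (x, false) :: u => FreeGroup.invRev (gamma (k - 1) x) ++ tauFrom (k - 1) u

/-- The Reidemeister–Schreier rewriting map `τ`, from words in `a`, `b` to words in the `S_k`. -/
def tau (u : Word Gen) : Word ℤ := tauFrom 0 u

/-- The Reidemeister–Schreier relator `R_0 = τ(w)` of `L(p/q)`, a word in the `S_k`. -/
def R0 (p : ℕ) (q : ℤ) : Word ℤ := tau (relator p q)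

/-- `S_k` or `S_k⁻¹` appears in the word `W`. -/
def Appears (k : ℤ) (W : Word ℤ) : Prop := ∃ s : Bool, (k, s) ∈ W

/-- The class `[W]` of a word `W` in the free abelian group on the `S_k`; the class `S'_k` of `S_k` is
`Finsupp.single k 1`. -/
noncomputable def abClass (W : Word ℤ) : ℤ →₀ ℤ :=
  (W.map fun x => Finsupp.single x.1 (if x.2 then (1 : ℤ) else -1)).sum

end TwoBridge

/-!
The partial exponent sums of the relator form a lattice path, `height p q`, with steps `ε_i` and period
`2 p`. The word `R₀` reads the odd edges of this path, an edge between the levels `k` and `k + 1` giving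
`S_k^{±1}`, so that the letters of top level are the odd edges adjacent to the maxima of the path, one
for each maximum (`edgeWord`, `R0_eq_edgeWord`). Everything is proved for both parities of edges.

Choose `p y - q x = 1` with `y` even and `|x| < p`; after replacing `q` by `-q`, which reverses the
path, `x > 0`. Translation by `x` lowers the path by one over `[1, p]` and raises it by one over
`[p + 1, 2 p]`, hence all maxima lie in `[1, x]` modulo `2 p` (`height_add_of_mem_left`,
`le_of_height_eq_of_isGreatest`). Write `p = C x + p₁` with `0 < p₁ ≤ x` and `q = C y + q₁`. The signs
of `(p, q)` and of `(p₁, q₁)` agree on `[0, x]` (`epsilon_eq_of_le`), so that this window of the path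
is an initial part of the periodic path of `(p₁, q₁)`. It follows that the word of `(p, q)` is `A ^ n V`
with `A` the word of `(p₁, q₁)`, `n = ⌊x / 2 p₁⌋ + 1`, and `V` free of letters of top level
(`exists_mk_edgeWord_eq_pow_mul`). Both paths have the same maximum, and the minimum of the second is
higher by `C`. Induction on `p` down to `p = 1`, where the word is a single letter, gives the chain at
the top (`exists_rootChain`).

The reflection of the path under translation by `p` and the fact that the path is closed give the
symmetry of the classes (`topSymmetric_edgeWord`). The same reflection turns the chain at the top, for
edges of parity shifted by `p`, into the one at the bottom with the same exponents
(`RootChain.flip`).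
-/

namespace TwoBridge

/-! ### The height function -/

/-- The exponent sum of the prefix of length `i` of the relator, extended to all `i : ℤ` so that the
increment from `i` to `i + 1` is `ε_i`: a lattice path whose edge from `i` to `i + 1` is the `i`-th
letter of the relator. The second sum is empty for `0 ≤ i`, the first one for `i ≤ 0`. -/
noncomputable def height (p : ℕ) (q : ℤ) (i : ℤ) : ℤ :=
  ∑ j ∈ Finset.Ico 0 i, (epsilon p q j : ℤ) - ∑ j ∈ Finset.Ico i 0, (epsilon p q j : ℤ)

theorem height_zero (p : ℕ) (q : ℤ) : height p q 0 = 0 := by simp [height]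

theorem height_succ (p : ℕ) (q i : ℤ) : height p q (i + 1) = height p q i + epsilon p q i := by
  unfold height
  rcases le_or_gt 0 i with hi | hi
  · have h1 : Finset.Ico (i + 1) 0 = ∅ := Finset.Ico_eq_empty (by omega)
    have h2 : Finset.Ico i 0 = ∅ := Finset.Ico_eq_empty (by omega)
    have h3 : Finset.Ico 0 (i + 1) = insert i (Finset.Ico 0 i) := by ext; simp; omega
    rw [h1, h2, h3, Finset.sum_insert (by simp)]
    simp only [Finset.sum_empty]
    ring
  · have h1 : Finset.Ico 0 (i + 1) = ∅ := Finset.Ico_eq_empty (by omega)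
    have h2 : Finset.Ico 0 i = ∅ := Finset.Ico_eq_empty (by omega)
    have h3 : Finset.Ico i 0 = insert i (Finset.Ico (i + 1) 0) := by ext; simp; omega
    rw [h1, h2, h3, Finset.sum_insert (by simp)]
    simp only [Finset.sum_empty]
    ring

theorem epsilon_eq_one_or (p : ℕ) (q i : ℤ) :
    (epsilon p q i : ℤ) = 1 ∨ (epsilon p q i : ℤ) = -1 := by
  rcases Int.units_eq_one_or (epsilon p q i) with h | h <;> simp [h]

theorem height_step (p : ℕ) (q i : ℤ) :
    height p q (i + 1) = height p q i + 1 ∨ height p q (i + 1) = height p q i - 1 := by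
  rw [height_succ]
  rcases epsilon_eq_one_or p q i with h | h <;> rw [h]
  · exact Or.inl rfl
  · exact Or.inr rfl

theorem eq_of_succ_eq {f : ℤ → ℤ} (hf : ∀ i, f (i + 1) = f i) (i : ℤ) : f i = f 0 := by
  induction i using Int.induction_on with
  | zero => rfl
  | succ i ih => rw [hf, ih]
  | pred i ih => rw [← ih, ← hf, sub_add_cancel]

section Epsilon

variable {p : ℕ} {q : ℤ}

theorem epsilon_zero : epsilon p q 0 = 1 := by simp [epsilon]

theorem epsilon_neg_right (i : ℤ) : epsilon p (-q) i = epsilon p q (-i) := by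
  simp [epsilon]

theorem epsilon_add_period (hp : 0 < p) (hq : Odd q) (i : ℤ) :
    epsilon p q (i + p) = -epsilon p q i := by
  have hp' : (p : ℤ) ≠ 0 := by exact_mod_cast hp.ne'
  have : (i + p) * q / (p : ℤ) = i * q / p + q := by
    rw [add_mul, mul_comm (p : ℤ) q, Int.add_mul_ediv_right _ _ hp']
  rw [epsilon, this, Int.negOnePow_add, Int.negOnePow_odd q hq, mul_neg_one, epsilon]

theorem epsilon_add_of_not_dvd (hp : 0 < p) (hpq : IsCoprime (p : ℤ) q) {x y : ℤ} (hy : Even y)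
    (hxy : p * y - q * x = 1) {i : ℤ} (hi : ¬ (p : ℤ) ∣ i) :
    epsilon p q (i + x) = epsilon p q i := by
  have hp' : (0 : ℤ) < p := by exact_mod_cast hp
  have hd : ¬ (p : ℤ) ∣ i * q := fun h => hi (hpq.dvd_of_dvd_mul_right h)
  have h1 := Int.emod_add_mul_ediv (i * q) p
  have h2 := Int.emod_lt_of_pos (i * q) hp'
  have h3 : 0 < i * q % (p : ℤ) :=
    lt_of_le_of_ne (Int.emod_nonneg _ hp'.ne') fun h => hd (Int.dvd_of_emod_eq_zero h.symm)
  have : (i + x) * q / (p : ℤ) = i * q / p + y := by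
    rw [Int.ediv_eq_iff_of_pos hp']
    constructor <;> nlinarith
  rw [epsilon, this, Int.negOnePow_add, Int.negOnePow_even y hy, mul_one, epsilon]

theorem epsilon_of_mul_sub_mul (hp : 0 < p) {x y : ℤ} (hy : Even y) (hxy : p * y - q * x = 1) :
    epsilon p q x = -1 := by
  have hp' : (0 : ℤ) < p := by exact_mod_cast hp
  have : x * q / (p : ℤ) = y - 1 := by
    rw [Int.ediv_eq_iff_of_pos hp']
    constructor <;> nlinarith
  rw [epsilon, this, Int.negOnePow_odd _ (hy.sub_odd odd_one)]

end Epsilon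

section Height

variable {p : ℕ} {q : ℤ}

theorem height_add_period (hp : 0 < p) (hq : Odd q) (i : ℤ) :
    height p q (i + p) = height p q p - height p q i := by
  have := eq_of_succ_eq (f := fun i => height p q (i + p) + height p q i) (fun i => by
    have h1 := height_succ p q (i + p)
    have h2 := height_succ p q i
    rw [epsilon_add_period hp hq] at h1
    rw [add_right_comm, h1, h2]
    push_cast
    ring) i
  simp only [zero_add, height_zero, add_zero] at this
  linarith

theorem height_add_two_period (hp : 0 < p) (hq : Odd q) (i : ℤ) :
    height p q (i + 2 * p) = height p q i := by
  rw [two_mul, ← add_assoc, height_add_period hp hq, height_add_period hp hq]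
  ring

/-- Replacing `q` by `-q` reverses the path; the reversal can be arranged to keep maxima maxima,
because the sign `ε_i` for `-q` is `ε_{-i} = -ε_{p-i}` for `q`. -/
theorem height_neg (hp : 0 < p) (hq : Odd q) (i : ℤ) :
    height p (-q) i = height p q (p + 1 - i) + -height p q (p + 1) := by
  have := eq_of_succ_eq (f := fun i => height p (-q) i - height p q (p + 1 - i)) (fun i => by
    have h1 := height_succ p (-q) i
    have h2 := height_succ p q (p - i)
    rw [epsilon_neg_right] at h1
    rw [show (p : ℤ) - i = -i + p by ring, epsilon_add_period hp hq] at h2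
    rw [h1, show (p : ℤ) + 1 - (i + 1) = -i + p by ring, show (p : ℤ) + 1 - i = -i + p + 1 by ring,
      h2]
    push_cast
    ring) i
  simp only [height_zero, sub_zero] at this
  linarith

/-- Translation by `x`, where `p y - q x = 1` with `y` even, changes `ε_i` only when `p ∣ i`. So
`height (i + x) - height i` is constant on `[1, p]`, and the antisymmetry under translation by `p`
makes it `-1` there. -/
theorem height_add_of_mem_left (hp : 0 < p) (hq : Odd q) (hpq : IsCoprime (p : ℤ) q) {x y : ℤ}
    (hy : Even y) (hxy : p * y - q * x = 1) {i : ℤ} (h1 : 1 ≤ i) (h2 : i ≤ p) :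
    height p q (i + x) = height p q i - 1 := by
  have key : ∀ j : ℤ, 1 ≤ j → j ≤ p →
      height p q (j + x) - height p q j = height p q (1 + x) - height p q 1 := by
    intro j hj
    induction j, hj using Int.leInduction with
    | base => intro _; rfl
    | succ j hj ih =>
      intro hjp
      have e1 := height_succ p q (j + x)
      have e2 := height_succ p q j
      rw [epsilon_add_of_not_dvd hp hpq hy hxy
        (fun h => by have := Int.le_of_dvd (by omega) h; omega)] at e1
      rw [add_right_comm, e1, e2, ← ih (by omega)]
      ring
  have e0 := height_succ p q x
  have e1 := height_succ p q 0
  rw [epsilon_of_mul_sub_mul hp hy hxy, add_comm x 1] at e0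
  rw [epsilon_zero, zero_add, height_zero] at e1
  have e2 := key p (by omega) le_rfl
  rw [add_comm (p : ℤ) x, height_add_period hp hq] at e2
  have e3 := key i h1 h2
  push_cast at e0 e1
  linarith

theorem height_add_of_mem_right (hp : 0 < p) (hq : Odd q) (hpq : IsCoprime (p : ℤ) q) {x y : ℤ}
    (hy : Even y) (hxy : p * y - q * x = 1) {i : ℤ} (h1 : p + 1 ≤ i) (h2 : i ≤ 2 * p) :
    height p q (i + x) = height p q i + 1 := by
  have e1 := height_add_of_mem_left hp hq hpq hy hxy (i := i - p) (by omega) (by omega)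
  have e2 := height_add_period hp hq (i - p + x)
  have e3 := height_add_period hp hq (i - p)
  rw [show i - p + x + p = i + x by ring] at e2
  rw [show i - p + p = i by ring] at e3
  linarith

end Height

/-- No lattice point with abscissa in `[0, x]` separates the lines of slopes `q / p` and `q₁ / p₁`, as
`q / p` lies between `q₁ / p₁` and `y / x`, which are Farey neighbours. -/
theorem epsilon_eq_of_le {p p₁ x C : ℕ} {q q₁ y : ℤ} (hp₁ : 0 < p₁) (hp : p = C * x + p₁)
    (hq : q = C * y + q₁) (hxy : p₁ * y - q₁ * x = 1) {i : ℤ} (h0 : 0 ≤ i) (hx : i ≤ x) :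
    epsilon p q i = epsilon p₁ q₁ i := by
  have hp₁' : (0 : ℤ) < p₁ := by exact_mod_cast hp₁
  have hp' : (0 : ℤ) < p := by exact_mod_cast (by omega : 0 < p)
  have hpz : (p : ℤ) = C * x + p₁ := by exact_mod_cast hp
  have hC : (0 : ℤ) ≤ C := by positivity
  have : i * q / (p : ℤ) = i * q₁ / (p₁ : ℤ) := by
    obtain ⟨hl, hu⟩ := (Int.ediv_eq_iff_of_pos hp₁').mp (rfl : i * q₁ / (p₁ : ℤ) = _)
    generalize i * q₁ / (p₁ : ℤ) = f at hl hu ⊢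
    rw [Int.ediv_eq_iff_of_pos hp']
    constructor
    · have : 0 ≤ (i * q - f * p) * p₁ := by
        have : (i * q - f * p) * p₁ = (i * q₁ - f * p₁) * p + i * C * (p₁ * y - q₁ * x) := by
          rw [hq, hpz]; ring
        rw [this, hxy]
        have h1 : 0 ≤ (i * q₁ - f * p₁) * p := mul_nonneg (by linarith) hp'.le
        have h2 : 0 ≤ i * C := mul_nonneg h0 hC
        linarith
      nlinarith [nonneg_of_mul_nonneg_left this hp₁']
    · have hv : 0 ≤ ((f + 1) * x - i * y) * p₁ := by
        have : ((f + 1) * x - i * y) * p₁ =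
            x * (f * p₁ + p₁ - i * q₁) - i * (p₁ * y - q₁ * x) := by ring
        rw [this, hxy]
        nlinarith
      have hv' := mul_nonneg hC (nonneg_of_mul_nonneg_left hv hp₁')
      have : f * p + p - i * q = C * ((f + 1) * x - i * y) + (f * p₁ + p₁ - i * q₁) := by
        rw [hq, hpz]; ring
      linarith
  rw [epsilon, this, epsilon]

/-! ### Edge words -/

/-- The contribution of the edge from `i` to `i + 1` of the path `h`: the letter `S_k^{±1}`, where `k`
is the lower end of the edge and the sign tells whether the edge goes up. Edges with `i + e` odd
contribute nothing. -/
def edgeLetter (h : ℤ → ℤ) (e i : ℤ) : Word ℤ :=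
  if Even (i + e) then [(min (h i) (h (i + 1)), decide (h i < h (i + 1)))] else []

/-- The word read along the edges `s, …, s + L - 1` of `h`, keeping one edge out of two as prescribed
by the parity of `e`. -/
def edgeWord (h : ℤ → ℤ) (e s : ℤ) (L : ℕ) : Word ℤ :=
  (List.range L).flatMap fun k : ℕ => edgeLetter h e (s + k)

theorem edgeWord_zero (h : ℤ → ℤ) (e s : ℤ) : edgeWord h e s 0 = [] := rfl

theorem edgeWord_add (h : ℤ → ℤ) (e s : ℤ) (L L' : ℕ) :
    edgeWord h e s (L + L') = edgeWord h e s L ++ edgeWord h e (s + L) L' := by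
  simp only [edgeWord, List.range_add, List.flatMap_append, List.flatMap_map]
  simp only [Nat.cast_add, add_assoc]

theorem edgeWord_one (h : ℤ → ℤ) (e s : ℤ) : edgeWord h e s 1 = edgeLetter h e s := by
  simp [edgeWord]

theorem edgeWord_succ (h : ℤ → ℤ) (e s : ℤ) (L : ℕ) :
    edgeWord h e s (L + 1) = edgeWord h e s L ++ edgeLetter h e (s + L) := by
  rw [edgeWord_add, edgeWord_one]

theorem edgeWord_succ' (h : ℤ → ℤ) (e s : ℤ) (L : ℕ) :
    edgeWord h e s (L + 1) = edgeLetter h e s ++ edgeWord h e (s + 1) L := by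
  rw [add_comm L 1, edgeWord_add, edgeWord_one, Nat.cast_one]

theorem edgeWord_map {h h' : ℤ → ℤ} {e e' s s' : ℤ} {F : ℤ × Bool → ℤ × Bool} {L : ℕ}
    (H : ∀ k : ℕ, k < L → edgeLetter h' e' (s' + k) = (edgeLetter h e (s + k)).map F) :
    edgeWord h' e' s' L = (edgeWord h e s L).map F := by
  induction L with
  | zero => rfl
  | succ L ih =>
    rw [edgeWord_succ, edgeWord_succ, List.map_append, ih fun k hk => H k (by omega),
      H L (by omega)]

theorem edgeWord_congr {h h' : ℤ → ℤ} {e s : ℤ} {L : ℕ}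
    (H : ∀ i, s ≤ i → i ≤ s + L → h' i = h i) : edgeWord h' e s L = edgeWord h e s L := by
  rw [edgeWord_map (h := h) (e := e) (s := s) (F := id), List.map_id]
  intro k hk
  rw [List.map_id, edgeLetter, edgeLetter, H _ (by omega) (by omega), H _ (by omega) (by omega)]

theorem add_mul_period {h : ℤ → ℤ} {P : ℕ} (hP : ∀ i, h (i + 2 * P) = h i) (n j : ℤ) :
    h (j + 2 * P * n) = h j := by
  have := eq_of_succ_eq (f := fun n => h (j + 2 * P * n))
    (fun n => by simpa [mul_add, ← add_assoc] using hP (j + 2 * P * n)) n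
  simpa using this

theorem exists_isGreatest_range {h : ℤ → ℤ} {P : ℕ} (hP0 : 0 < P)
    (hP : ∀ i, h (i + 2 * P) = h i) : ∃ T, IsGreatest (Set.range h) T := by
  have hpos : (0 : ℤ) < 2 * P := by positivity
  obtain ⟨i, -, hi⟩ := Finset.exists_max_image (Finset.Ico 0 (2 * (P : ℤ))) h
    ⟨0, by simpa using hpos⟩
  refine ⟨h i, ⟨i, rfl⟩, ?_⟩
  rintro _ ⟨j, rfl⟩
  rw [← Int.emod_add_mul_ediv j (2 * P), add_mul_period hP]
  exact hi _ (Finset.mem_Ico.mpr ⟨Int.emod_nonneg _ hpos.ne', Int.emod_lt_of_pos _ hpos⟩)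

theorem edgeWord_add_period {h : ℤ → ℤ} {P : ℕ} (hP : ∀ i, h (i + 2 * P) = h i) (e s : ℤ) (L : ℕ) :
    edgeWord h e (s + 2 * P) L = edgeWord h e s L := by
  rw [edgeWord_map (h := h) (e := e) (s := s) (F := id), List.map_id]
  intro k _
  have h1 := hP (s + k)
  have h2 := hP (s + k + 1)
  have h3 : Even (s + 2 * P + k + e) ↔ Even (s + k + e) := by
    rw [show s + 2 * P + k + e = s + k + e + 2 * P by ring, Int.even_add]
    simp
  rw [List.map_id, edgeLetter, edgeLetter]
  simp only [h3]
  rw [show s + 2 * (P : ℤ) + k = s + k + 2 * P by ring, h1,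
    show s + k + 2 * (P : ℤ) + 1 = s + k + 1 + 2 * P by ring, h2]

theorem mk_edgeWord_mul_period {h : ℤ → ℤ} {P : ℕ} (hP : ∀ i, h (i + 2 * P) = h i) (e : ℤ)
    (n : ℕ) :
    FreeGroup.mk (edgeWord h e 0 (n * (2 * P))) = FreeGroup.mk (edgeWord h e 0 (2 * P)) ^ n := by
  induction n with
  | zero => rw [zero_mul, edgeWord_zero, pow_zero, FreeGroup.one_eq_mk]
  | succ n ih =>
    rw [pow_succ', ← ih, add_mul, one_mul, add_comm, edgeWord_add]
    push_cast
    rw [edgeWord_add_period hP, FreeGroup.mul_mk]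

theorem exists_edgeWord_rotate {h : ℤ → ℤ} {P : ℕ} (hP : ∀ i, h (i + 2 * P) = h i) (e : ℤ) {s : ℕ}
    (hs : s ≤ 2 * P) : ∃ X Y : Word ℤ,
      edgeWord h e 0 (2 * P) = X ++ Y ∧ edgeWord h e s (2 * P) = Y ++ X := by
  refine ⟨edgeWord h e 0 s, edgeWord h e s (2 * P - s), ?_, ?_⟩
  · conv_lhs => rw [show 2 * P = s + (2 * P - s) by omega, edgeWord_add, zero_add]
  · conv_lhs => rw [show 2 * P = (2 * P - s) + s by omega, edgeWord_add]
    congr 1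
    rw [← edgeWord_add_period hP e 0 s]
    congr 1
    push_cast [hs]
    ring

theorem isConj_mk_append (X Y : Word ℤ) :
    IsConj (FreeGroup.mk (X ++ Y)) (FreeGroup.mk (Y ++ X)) := by
  rw [← FreeGroup.mul_mk, ← FreeGroup.mul_mk, isConj_iff]
  exact ⟨(FreeGroup.mk X)⁻¹, by group⟩

theorem isConj_mk_edgeWord_rotate {h : ℤ → ℤ} {P : ℕ} (hP : ∀ i, h (i + 2 * P) = h i) (e : ℤ)
    {s : ℕ} (hs : s ≤ 2 * P) : IsConj (FreeGroup.mk (edgeWord h e 0 (2 * P)))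
      (FreeGroup.mk (edgeWord h e s (2 * P))) := by
  obtain ⟨X, Y, h1, h2⟩ := exists_edgeWord_rotate hP e hs
  rw [h1, h2]
  exact isConj_mk_append X Y

theorem appears_append {k : ℤ} {X Y : Word ℤ} :
    Appears k (X ++ Y) ↔ Appears k X ∨ Appears k Y := by
  simp [Appears, exists_or]

theorem appears_invRev {k : ℤ} {X : Word ℤ} : Appears k (FreeGroup.invRev X) ↔ Appears k X := by
  simp only [Appears, FreeGroup.invRev, List.mem_reverse, List.mem_map, Prod.mk.injEq]
  constructor
  · rintro ⟨s, ⟨a, b⟩, h, rfl, -⟩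
    exact ⟨b, h⟩
  · rintro ⟨s, h⟩
    exact ⟨!s, (k, s), h, rfl, rfl⟩

theorem appears_edgeLetter {h : ℤ → ℤ} {e i k : ℤ} :
    Appears k (edgeLetter h e i) ↔ Even (i + e) ∧ min (h i) (h (i + 1)) = k := by
  unfold Appears edgeLetter
  split_ifs with hi <;> simp [hi, eq_comm]

theorem appears_edgeWord {h : ℤ → ℤ} {e s k : ℤ} {L : ℕ} :
    Appears k (edgeWord h e s L) ↔
      ∃ i, s ≤ i ∧ i < s + L ∧ Even (i + e) ∧ min (h i) (h (i + 1)) = k := by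
  induction L with
  | zero =>
    simp only [edgeWord_zero, Appears, List.not_mem_nil, exists_false, false_iff]
    rintro ⟨i, h1, h2, -⟩
    simp at h2
    omega
  | succ L ih =>
    rw [edgeWord_succ, appears_append, ih, appears_edgeLetter]
    constructor
    · rintro (⟨i, h1, h2, h3⟩ | h)
      · exact ⟨i, h1, by push_cast; omega, h3⟩
      · exact ⟨s + L, by omega, by push_cast; omega, h⟩
    · rintro ⟨i, h1, h2, h3⟩
      push_cast at h2
      by_cases hi : i < s + L
      · exact Or.inl ⟨i, h1, hi, h3⟩
      · obtain rfl : i = s + L := by omega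
        exact Or.inr h3

theorem appears_edgeWord_period {h : ℤ → ℤ} {P : ℕ} (hP0 : 0 < P) (hP : ∀ i, h (i + 2 * P) = h i)
    {e k : ℤ} : Appears k (edgeWord h e 0 (2 * P)) ↔
      ∃ i, Even (i + e) ∧ min (h i) (h (i + 1)) = k := by
  rw [appears_edgeWord]
  constructor
  · rintro ⟨i, -, -, h⟩
    exact ⟨i, h⟩
  · rintro ⟨i, h1, h2⟩
    have hpos : (0 : ℤ) < 2 * P := by positivity
    have hd := Int.emod_add_mul_ediv i (2 * P)
    refine ⟨i % (2 * P), Int.emod_nonneg _ hpos.ne', ?_, ?_, ?_⟩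
    · push_cast
      linarith [Int.emod_lt_of_pos i hpos]
    · rw [← hd, add_right_comm, Int.even_add] at h1
      exact h1.mpr ⟨P * (i / (2 * P)), by ring⟩
    · rw [← add_mul_period hP (i / (2 * P)) (i % (2 * P)),
        ← add_mul_period hP (i / (2 * P)) (i % (2 * P) + 1), add_right_comm, hd, h2]

/-! ### Classes in the free abelian group, and symmetries of words -/

theorem abClass_append (X Y : Word ℤ) : abClass (X ++ Y) = abClass X + abClass Y := by
  simp [abClass]

theorem abClass_cons (x : ℤ × Bool) (X : Word ℤ) :
    abClass (x :: X) = Finsupp.single x.1 (if x.2 then (1 : ℤ) else -1) + abClass X := by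
  simp [abClass]

theorem abClass_eq_zero_of_not_appears {k : ℤ} {W : Word ℤ} (h : ¬ Appears k W) :
    abClass W k = 0 := by
  induction W with
  | nil => simp [abClass]
  | cons x W ih =>
    have h1 : x.1 ≠ k := fun hx => h ⟨x.2, by simp [← hx]⟩
    have h2 : ¬ Appears k W := fun ⟨s, hs⟩ => h ⟨s, List.mem_cons_of_mem _ hs⟩
    rw [abClass_cons, Finsupp.add_apply, ih h2, Finsupp.single_eq_of_ne (Ne.symm h1), add_zero]

theorem abClass_invRev (W : Word ℤ) : abClass (FreeGroup.invRev W) = -abClass W := by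
  induction W with
  | nil => simp [abClass, FreeGroup.invRev]
  | cons x W ih =>
    have : FreeGroup.invRev (x :: W) = FreeGroup.invRev W ++ [(x.1, !x.2)] := by
      simp [FreeGroup.invRev]
    rw [this, abClass_append, ih, abClass_cons, abClass_cons]
    rcases x with ⟨a, _ | _⟩ <;> simp [abClass]

/-- The substitution `S_k ↦ S_{k+t}`. -/
def shiftWord (t : ℤ) (W : Word ℤ) : Word ℤ := W.map fun x => (x.1 + t, x.2)

/-- The substitution `S_k ↦ S_{c-k}⁻¹`. -/
def flipWord (c : ℤ) (W : Word ℤ) : Word ℤ := W.map fun x => (c - x.1, !x.2)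

theorem mk_shiftWord (t : ℤ) (W : Word ℤ) :
    FreeGroup.mk (shiftWord t W) = FreeGroup.map (· + t) (FreeGroup.mk W) := by
  rw [FreeGroup.map.mk]; rfl

theorem mk_flipWord (c : ℤ) (W : Word ℤ) : FreeGroup.mk (flipWord c W) =
    FreeGroup.lift (fun k => (FreeGroup.of (c - k))⁻¹) (FreeGroup.mk W) := by
  induction W with
  | nil => simp [flipWord, ← FreeGroup.one_eq_mk]
  | cons x W ih =>
    have h1 : FreeGroup.mk (x :: W) = FreeGroup.mk [x] * FreeGroup.mk W := by
      rw [FreeGroup.mul_mk]; rfl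
    have h2 : FreeGroup.mk (flipWord c (x :: W)) =
        FreeGroup.mk [(c - x.1, !x.2)] * FreeGroup.mk (flipWord c W) := by
      rw [FreeGroup.mul_mk]; rfl
    rw [h1, h2, map_mul, ih]
    rcases x with ⟨a, _ | _⟩ <;> simp [FreeGroup.of, FreeGroup.inv_mk, FreeGroup.invRev]

theorem appears_shiftWord {t k : ℤ} {W : Word ℤ} :
    Appears (k + t) (shiftWord t W) ↔ Appears k W := by
  simp [Appears, shiftWord]

theorem appears_flipWord {c k : ℤ} {W : Word ℤ} :
    Appears (c - k) (flipWord c W) ↔ Appears k W := by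
  simp [Appears, flipWord, or_comm]

theorem abClass_shiftWord (t : ℤ) (W : Word ℤ) (k : ℤ) :
    abClass (shiftWord t W) (k + t) = abClass W k := by
  induction W with
  | nil => simp [abClass, shiftWord]
  | cons x W ih =>
    have : shiftWord t (x :: W) = (x.1 + t, x.2) :: shiftWord t W := rfl
    rw [this, abClass_cons, abClass_cons, Finsupp.add_apply, Finsupp.add_apply, ih]
    simp [Finsupp.single_apply]

theorem abClass_flipWord (c : ℤ) (W : Word ℤ) (k : ℤ) :
    abClass (flipWord c W) (c - k) = -abClass W k := by
  induction W with
  | nil => simp [abClass, flipWord]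
  | cons x W ih =>
    have : flipWord c (x :: W) = (c - x.1, !x.2) :: flipWord c W := rfl
    rw [this, abClass_cons, abClass_cons, Finsupp.add_apply, Finsupp.add_apply, ih]
    rcases x with ⟨a, _ | _⟩ <;> simp [Finsupp.single_apply, add_comm]

/-- Edges of both parities together cross from level `k` to level `k + 1` with a net count that
depends only on the end points of the path. -/
theorem abClass_edgeWord_add_succ {h : ℤ → ℤ} (hs : ∀ i, h (i + 1) = h i + 1 ∨ h (i + 1) = h i - 1)
    (e s k : ℤ) (L : ℕ) : abClass (edgeWord h e s L) k + abClass (edgeWord h (e + 1) s L) k =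
      (if k < h (s + L) then 1 else 0) - (if k < h s then 1 else 0) := by
  induction L with
  | zero => simp [edgeWord_zero, abClass]
  | succ L ih =>
    rw [edgeWord_succ, edgeWord_succ, abClass_append, abClass_append, Finsupp.add_apply,
      Finsupp.add_apply, add_add_add_comm, ih]
    have : abClass (edgeLetter h e (s + L)) k + abClass (edgeLetter h (e + 1) (s + L)) k =
        (if k < h (s + L + 1) then 1 else 0) - (if k < h (s + L) then 1 else 0) := by
      have hpar : Even (s + L + (e + 1)) ↔ ¬ Even (s + L + e) := by
        rw [← add_assoc, Int.even_add_one]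
      have hd : abClass [(min (h (s + L)) (h (s + L + 1)),
          decide (h (s + L) < h (s + L + 1)))] k =
          (if k < h (s + L + 1) then 1 else 0) - (if k < h (s + L) then 1 else 0) := by
        rcases hs (s + L) with h1 | h1 <;> rw [h1] <;>
          simp [abClass, Finsupp.single_apply] <;> grind
      have h0 : abClass ([] : Word ℤ) k = 0 := by simp [abClass]
      unfold edgeLetter
      simp only [hpar]
      by_cases hE : Even (s + L + e) <;>
        simp only [hE, not_true, not_false_iff, if_true, if_false, hd, h0, add_zero, zero_add]
    rw [this]
    push_cast
    rw [← add_assoc]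
    ring

/-! ### Symmetries of edge words -/

theorem edgeWord_reflect {h h' : ℤ → ℤ} {c t : ℤ}
    (hs : ∀ i, h' (i + 1) = h' i + 1 ∨ h' (i + 1) = h' i - 1)
    (hh : ∀ i, h i = h' (c + 1 - i) + t) (e s : ℤ) (L : ℕ) :
    edgeWord h e s L =
      shiftWord t (FreeGroup.invRev (edgeWord h' (e + c) (c + 1 - s - L) L)) := by
  induction L with
  | zero => rfl
  | succ L ih =>
    have hl : edgeLetter h e (s + L) =
        shiftWord t (FreeGroup.invRev (edgeLetter h' (e + c) (c - s - L))) := by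
      have hpar : Even (c - s - L + (e + c)) ↔ Even (s + L + e) := by
        rw [show c - s - L + (e + c) = s + L + e + 2 * (c - s - L) by ring, Int.even_add]
        simp
      have h1 := hh (s + L)
      have h2 := hh (s + L + 1)
      rw [show c + 1 - (s + L) = c - s - L + 1 by ring] at h1
      rw [show c + 1 - (s + L + 1) = c - s - L by ring] at h2
      unfold edgeLetter
      simp only [hpar, h1, h2]
      split_ifs
      · rcases hs (c - s - L) with h3 | h3 <;> rw [h3] <;>
          simp [shiftWord, FreeGroup.invRev]
      · rfl
    rw [edgeWord_succ, ih, hl, edgeWord_succ', FreeGroup.invRev_append]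
    push_cast
    rw [show c + 1 - s - ((L : ℤ) + 1) = c - s - L by ring,
      show c - s - (L : ℤ) + 1 = c + 1 - s - L by ring]
    exact (List.map_append ..).symm

theorem edgeWord_flip {h : ℤ → ℤ} {c : ℤ}
    (hs : ∀ i, h (i + 1) = h i + 1 ∨ h (i + 1) = h i - 1) {P : ℤ}
    (hh : ∀ i, h (i + P) = c - h i) (e : ℤ) (L : ℕ) :
    edgeWord h e P L = flipWord (c - 1) (edgeWord h (e + P) 0 L) := by
  apply edgeWord_map
  intro k _
  have hpar : Even (0 + (k : ℤ) + (e + P)) ↔ Even (P + k + e) := by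
    rw [show 0 + (k : ℤ) + (e + P) = P + k + e by ring]
  have h1 := hh k
  have h2 := hh (k + 1)
  unfold edgeLetter
  simp only [hpar]
  rw [show P + (k : ℤ) = k + P by ring, show (k : ℤ) + P + 1 = k + 1 + P by ring, h1, h2, zero_add]
  split_ifs
  · rcases hs k with h3 | h3 <;> rw [h3] <;> simp <;> omega
  · rfl

/-! ### Chains of roots -/

/-- `RootChain M C [n₁, …, n_N] W`: there are words `A_0 = W, A_1, …, A_N` and `V_1, …, V_N` such that
`A_{i-1}` is conjugate to `A_i ^ n_i V_i`, the letter `S_M` does not appear in `V_i`, each `A_i` with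
`i ≥ 1` satisfies `C`, and `A_N` is `S_M` or its inverse. The exponents are part of the data, as the
top and the bottom of a word have to share them. -/
def RootChain (M : ℤ) (C : Word ℤ → Prop) : List ℕ → Word ℤ → Prop
  | [], W => W = [(M, true)] ∨ W = [(M, false)]
  | n :: ns, W => 0 < n ∧ ∃ A V : Word ℤ,
      IsConj (FreeGroup.mk W) (FreeGroup.mk A ^ n * FreeGroup.mk V) ∧ ¬ Appears M V ∧ C A ∧
        RootChain M C ns A

theorem RootChain.map {M M' : ℤ} {C C' : Word ℤ → Prop} {F : Word ℤ → Word ℤ}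
    (hconj : ∀ {W A V : Word ℤ} {n : ℕ},
      IsConj (FreeGroup.mk W) (FreeGroup.mk A ^ n * FreeGroup.mk V) →
        IsConj (FreeGroup.mk (F W)) (FreeGroup.mk (F A) ^ n * FreeGroup.mk (F V)))
    (happ : ∀ {V : Word ℤ}, Appears M' (F V) → Appears M V) (hC : ∀ {A : Word ℤ}, C A → C' (F A))
    (hF : ∀ b, F [(M, b)] = [(M', !b)]) {ns : List ℕ} {W : Word ℤ} (H : RootChain M C ns W) :
    RootChain M' C' ns (F W) := by
  induction ns generalizing W with
  | nil =>
    rcases H with rfl | rfl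
    · exact Or.inr (hF true)
    · exact Or.inl (hF false)
  | cons n ns ih =>
    obtain ⟨hn, A, V, h1, h2, h3, h4⟩ := H
    exact ⟨hn, F A, F V, hconj h1, fun h => h2 (happ h), hC h3, ih h4⟩

theorem RootChain.mono {M : ℤ} {C C' : Word ℤ → Prop} (hC : ∀ {A : Word ℤ}, C A → C' A)
    {ns : List ℕ} {W : Word ℤ} (H : RootChain M C ns W) : RootChain M C' ns W := by
  induction ns generalizing W with
  | nil => exact H
  | cons n ns ih =>
    obtain ⟨hn, A, V, h1, h2, h3, h4⟩ := H
    exact ⟨hn, A, V, h1, h2, hC h3, ih h4⟩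

theorem RootChain.of_isConj {M : ℤ} {C : Word ℤ → Prop} {ns : List ℕ} (hns : ns ≠ [])
    {W W' : Word ℤ} (hW : IsConj (FreeGroup.mk W') (FreeGroup.mk W)) (H : RootChain M C ns W) :
    RootChain M C ns W' := by
  cases ns with
  | nil => exact absurd rfl hns
  | cons n ns =>
    obtain ⟨hn, A, V, h1, h2⟩ := H
    exact ⟨hn, A, V, hW.trans h1, h2⟩

theorem RootChain.exists_sequences {M : ℤ} {C : Word ℤ → Prop} {ns : List ℕ} {W : Word ℤ}
    (H : RootChain M C ns W) : ∃ A V : ℕ → Word ℤ, A 0 = W ∧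
      (A ns.length = [(M, true)] ∨ A ns.length = [(M, false)]) ∧
      ∀ i ∈ Finset.Icc 1 ns.length, 0 < ns.getD (i - 1) 0 ∧
        IsConj (FreeGroup.mk (A (i - 1)))
          (FreeGroup.mk (A i) ^ ns.getD (i - 1) 0 * FreeGroup.mk (V i)) ∧
        ¬ Appears M (V i) ∧ C (A i) := by
  induction ns generalizing W with
  | nil => exact ⟨fun _ => W, fun _ => [], rfl, H, by simp⟩
  | cons n ns ih =>
    obtain ⟨hn, A₁, V₁, h1, h2, h3, h4⟩ := H
    obtain ⟨A, V, hA0, hAN, hi⟩ := ih h4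
    refine ⟨fun i => i.casesOn W A, fun i => i.casesOn [] fun j => j.casesOn V₁ fun k => V (k + 1),
      rfl, hAN, fun i hmem => ?_⟩
    obtain ⟨hl, hu⟩ := Finset.mem_Icc.mp hmem
    obtain ⟨j, rfl⟩ := Nat.exists_eq_add_of_le' hl
    cases j with
    | zero => exact ⟨hn, by simpa [hA0] using h1, h2, by simpa [hA0] using h3⟩
    | succ k => simpa using hi (k + 1) (Finset.mem_Icc.mpr ⟨by omega, by simpa using hu⟩)

/-! ### Symmetric classes -/

/-- The class of `A` is supported in an interval `[l, M]` with `m < l ≤ M` and its coefficients are, up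
to sign, symmetric about the middle of the interval. The symmetry is stated for all `k`, and then
implies that the class vanishes above `M`. -/
def TopSymmetric (m M : ℤ) (A : Word ℤ) : Prop :=
  ∃ l, m < l ∧ l ≤ M ∧ (∀ k, k < l → abClass A k = 0) ∧
    ∀ k, |abClass A (l + M - k)| = |abClass A k|

/-- The mirror image of `TopSymmetric`: the class is supported in `[m, l]` with `m ≤ l < M`. -/
def BottomSymmetric (m M : ℤ) (A : Word ℤ) : Prop :=
  ∃ l, m ≤ l ∧ l < M ∧ (∀ k, l < k → abClass A k = 0) ∧
    ∀ k, |abClass A (m + l - k)| = |abClass A k|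

theorem finsupp_eq_sum_Icc {f : ℤ →₀ ℤ} {l u : ℤ} (hl : ∀ k, k < l → f k = 0)
    (hu : ∀ k, u < k → f k = 0) :
    f = ∑ j ∈ Finset.Icc l u, f j • Finsupp.single j (1 : ℤ) := by
  ext k
  rw [Finsupp.finsetSum_apply]
  by_cases hk : k ∈ Finset.Icc l u
  · rw [Finset.sum_eq_single_of_mem k hk]
    · simp
    · intro j _ hj
      simp [hj]
  · rw [Finset.sum_eq_zero]
    · rw [Finset.mem_Icc, not_and_or, not_le, not_le] at hk
      exact hk.elim (hl k) (hu k)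
    · intro j hj
      have : j ≠ k := fun h => hk (h ▸ hj)
      simp [this]

theorem TopSymmetric.exists_coeff {m M : ℤ} {A : Word ℤ} (H : TopSymmetric m M A) :
    ∃ l : ℤ, m < l ∧ l ≤ M ∧ ∃ b : ℤ → ℤ,
      abClass A = ∑ j ∈ Finset.Icc l M, b j • Finsupp.single j (1 : ℤ) ∧
      ∀ j : ℤ, 0 ≤ j → j ≤ M - l → |b (l + j)| = |b (M - j)| := by
  obtain ⟨l, h1, h2, h3, h4⟩ := H
  refine ⟨l, h1, h2, abClass A, finsupp_eq_sum_Icc h3 fun k hk => ?_, fun j _ _ => ?_⟩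
  · rw [← abs_eq_zero, ← h4, h3 _ (by omega), abs_zero]
  · rw [← h4, show l + M - (l + j) = M - j by ring]

theorem BottomSymmetric.exists_coeff {m M : ℤ} {A : Word ℤ} (H : BottomSymmetric m M A) :
    ∃ l : ℤ, m ≤ l ∧ l < M ∧ ∃ b : ℤ → ℤ,
      abClass A = ∑ j ∈ Finset.Icc m l, b j • Finsupp.single j (1 : ℤ) ∧
      ∀ j : ℤ, 0 ≤ j → j ≤ l - m → |b (m + j)| = |b (l - j)| := by
  obtain ⟨l, h1, h2, h3, h4⟩ := H
  refine ⟨l, h1, h2, abClass A, finsupp_eq_sum_Icc (fun k hk => ?_) h3, fun j _ _ => ?_⟩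
  · rw [← abs_eq_zero, ← h4, h3 _ (by omega), abs_zero]
  · rw [← h4, show m + l - (m + j) = l - j by ring]

theorem RootChain.flip {m M c : ℤ} (hc : m + M = c) {ns : List ℕ} {W : Word ℤ}
    (H : RootChain M (TopSymmetric m M) ns W) :
    RootChain m (BottomSymmetric m M) ns (flipWord c W) := by
  subst hc
  refine H.map (F := flipWord (m + M)) ?_ ?_ ?_ ?_
  · intro W A V n h
    simpa only [mk_flipWord, map_mul, map_pow] using
      MonoidHom.map_isConj (FreeGroup.lift fun k => (FreeGroup.of (m + M - k))⁻¹) h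
  · intro V h
    have := appears_flipWord (c := m + M) (k := M) (W := V)
    rw [add_sub_cancel_right] at this
    exact this.mp h
  · rintro A ⟨l, h1, h2, h3, h4⟩
    have key : ∀ k, abClass (flipWord (m + M) A) k = -abClass A (m + M - k) := fun k => by
      rw [← abClass_flipWord (m + M), sub_sub_cancel]
    refine ⟨m + M - l, by omega, by omega, fun k hk => ?_, fun k => ?_⟩
    · rw [key, h3 _ (by omega), neg_zero]
    · rw [key, key, abs_neg, abs_neg, ← h4 (m + M - k)]
      congr 2
      ring
  · intro b
    simp [flipWord]

theorem RootChain.reflect {m M t : ℤ} {ns : List ℕ} {W : Word ℤ}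
    (H : RootChain M (TopSymmetric m M) ns W) :
    RootChain (M + t) (TopSymmetric (m + t) (M + t)) ns
      (shiftWord t (FreeGroup.invRev W)) := by
  have hmk : ∀ W, FreeGroup.mk (shiftWord t (FreeGroup.invRev W)) =
      (FreeGroup.map (· + t) (FreeGroup.mk W))⁻¹ := fun W => by
    rw [mk_shiftWord, ← FreeGroup.inv_mk, map_inv]
  refine H.map (F := fun W => shiftWord t (FreeGroup.invRev W)) ?_ ?_ ?_ ?_
  · intro W A V n h
    have h1 := MonoidHom.map_isConj (FreeGroup.map (· + t)) h
    rw [map_mul, map_pow] at h1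
    rw [hmk, hmk, hmk, inv_pow]
    obtain ⟨c, hc⟩ := isConj_iff.mp h1
    generalize FreeGroup.map (· + t) (FreeGroup.mk W) = w at hc ⊢
    generalize FreeGroup.map (· + t) (FreeGroup.mk A) ^ n = a at hc ⊢
    generalize FreeGroup.map (· + t) (FreeGroup.mk V) = v at hc ⊢
    rw [isConj_iff]
    refine ⟨v * c, ?_⟩
    have : w⁻¹ = c⁻¹ * (a * v)⁻¹ * c := by rw [← hc]; group
    rw [this]
    group
  · intro V h
    exact appears_invRev.mp (appears_shiftWord.mp h)
  · rintro A ⟨l, h1, h2, h3, h4⟩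
    have key : ∀ k, abClass (shiftWord t (FreeGroup.invRev A)) k = -abClass A (k - t) := fun k => by
      conv_lhs => rw [← sub_add_cancel k t, abClass_shiftWord, abClass_invRev, Finsupp.neg_apply]
    refine ⟨l + t, by omega, by omega, fun k hk => ?_, fun k => ?_⟩
    · rw [key, h3 _ (by omega), neg_zero]
    · rw [key, key, abs_neg, abs_neg, ← h4 (k - t)]
      congr 2
      ring
  · intro b
    simp [shiftWord, FreeGroup.invRev]

/-! ### The edge words of a two-bridge link -/

section Symmetry

variable {p : ℕ} {q : ℤ}

/-- Along a closed path, the edges of the two parities have opposite classes. -/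
theorem abs_abClass_edgeWord_add {h : ℤ → ℤ} {P : ℕ}
    (hs : ∀ i, h (i + 1) = h i + 1 ∨ h (i + 1) = h i - 1) (hP : ∀ i, h (i + 2 * P) = h i)
    (e k : ℤ) (n : ℕ) : |abClass (edgeWord h (e + n) 0 (2 * P)) k| =
      |abClass (edgeWord h e 0 (2 * P)) k| := by
  induction n with
  | zero => simp
  | succ n ih =>
    have h1 := abClass_edgeWord_add_succ hs (e + n) 0 k (2 * P)
    have h2 := hP 0
    push_cast at h1 ⊢
    rw [h2, sub_self] at h1
    rw [← ih, ← abs_neg, ← add_assoc, eq_neg_of_add_eq_zero_left h1]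

theorem height_self_add_one_le_of_isGreatest (hp : 0 < p) (hq : Odd q) {T : ℤ}
    (hT : IsGreatest (Set.range (height p q)) T) : height p q p + 1 ≤ 2 * T := by
  have h1 := hT.2 ⟨0 + 1, rfl⟩
  have h2 := hT.2 ⟨0 + p, rfl⟩
  rw [height_add_period hp hq, height_zero] at h2
  rw [height_succ, height_zero, epsilon_zero] at h1
  push_cast at h1
  linarith

/-- Translation by `p` reflects the path, which exchanges the levels `k` and `height p - 1 - k` and
possibly the two parities of edges; the latter changes only the sign of the class. -/
theorem topSymmetric_edgeWord (hp : 0 < p) (hq : Odd q) {T m : ℤ}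
    (hT : IsGreatest (Set.range (height p q)) T) (hm : m < height p q p - T) (e : ℤ) :
    TopSymmetric m (T - 1) (edgeWord (height p q) e 0 (2 * p)) := by
  have hP := height_add_two_period hp hq
  refine ⟨height p q p - T, hm, ?_, fun k hk => ?_, fun k => ?_⟩
  · linarith [height_self_add_one_le_of_isGreatest hp hq hT]
  · apply abClass_eq_zero_of_not_appears
    rw [appears_edgeWord_period hp hP]
    rintro ⟨i, -, hi⟩
    have h1 := hT.2 ⟨i + p, rfl⟩
    have h2 := hT.2 ⟨i + 1 + p, rfl⟩
    rw [height_add_period hp hq] at h1 h2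
    rcases min_choice (height p q i) (height p q (i + 1)) with h3 | h3 <;> linarith
  · have h1 : abClass (edgeWord (height p q) e 0 (2 * p)) =
        abClass (edgeWord (height p q) e p (2 * p)) := by
      obtain ⟨X, Y, h1, h2⟩ := exists_edgeWord_rotate hP e (s := p) (by omega)
      rw [h1, h2, abClass_append, abClass_append, add_comm]
    conv_lhs => rw [h1, edgeWord_flip (height_step p q) (height_add_period hp hq)]
    rw [show height p q p - T + (T - 1) - k = height p q p - 1 - k by ring, abClass_flipWord,
      abs_neg, abs_abClass_edgeWord_add (height_step p q) hP]

theorem isGreatest_appears_edgeWord (hp : 0 < p) (hq : Odd q) {T : ℤ}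
    (hT : IsGreatest (Set.range (height p q)) T) (e : ℤ) :
    IsGreatest {k | Appears k (edgeWord (height p q) e 0 (2 * p))} (T - 1) := by
  have hP := height_add_two_period hp hq
  simp only [appears_edgeWord_period hp hP]
  constructor
  · obtain ⟨i, hi⟩ := hT.1
    have h1 := height_step p q i
    have h2 := hT.2 ⟨i + 1, rfl⟩
    have h3 := height_step p q (i - 1)
    have h4 := hT.2 ⟨i - 1, rfl⟩
    rw [sub_add_cancel] at h3
    by_cases he : Even (i + e)
    · exact ⟨i, he, by omega⟩
    · refine ⟨i - 1, ?_, by rw [sub_add_cancel]; omega⟩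
      rw [show i - 1 + e = i + e - 1 by ring]
      exact (Int.not_even_iff_odd.mp he).sub_odd odd_one
  · rintro k ⟨i, -, hi⟩
    have h1 := height_step p q i
    have h2 := hT.2 ⟨i, rfl⟩
    have h3 := hT.2 ⟨i + 1, rfl⟩
    omega

theorem isLeast_appears_edgeWord (hp : 0 < p) (hq : Odd q) {T : ℤ}
    (hT : IsGreatest (Set.range (height p q)) T) (e : ℤ) :
    IsLeast {k | Appears k (edgeWord (height p q) e 0 (2 * p))} (height p q p - T) := by
  have hP := height_add_two_period hp hq
  have key : ∀ k, Appears k (edgeWord (height p q) e 0 (2 * p)) ↔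
      Appears (height p q p - 1 - k) (edgeWord (height p q) (e + p) 0 (2 * p)) := fun k => by
    have h1 : Appears k (edgeWord (height p q) e 0 (2 * p)) ↔
        Appears k (edgeWord (height p q) e p (2 * p)) := by
      obtain ⟨X, Y, h1, h2⟩ := exists_edgeWord_rotate hP e (s := p) (by omega)
      rw [h1, h2, appears_append, appears_append, or_comm]
    rw [h1, edgeWord_flip (height_step p q) (height_add_period hp hq),
      ← appears_flipWord (c := height p q p - 1) (k := height p q p - 1 - k), sub_sub_cancel]
  obtain ⟨h1, h2⟩ := isGreatest_appears_edgeWord hp hq hT (e + p)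
  constructor
  · refine (key _).mpr ?_
    rw [show height p q p - 1 - (height p q p - T) = T - 1 by ring]
    exact h1
  · intro k hk
    have := h2 ((key k).mp hk)
    linarith

end Symmetry

/-! ### Rewriting the relator -/

section Relator

theorem tauFrom_map_range' (p : ℕ) (q : ℤ) (L s : ℕ) :
    tauFrom (height p q s) ((List.range' s L).map fun i : ℕ =>
      (if Even (i : ℤ) then Gen.a else Gen.b, decide (epsilon p q (i : ℤ) = 1))) =
      edgeWord (height p q) 1 s L := by
  induction L generalizing s with
  | zero => rfl
  | succ L ih =>
    rw [List.range'_succ, List.map_cons, edgeWord_succ']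
    have hsucc := height_succ p q s
    have ih' := ih (s + 1)
    push_cast at ih'
    have hpar : Even ((s : ℤ) + 1) ↔ ¬ Even (s : ℤ) := Int.even_add_one
    rcases Int.units_eq_one_or (epsilon p q s) with h | h <;> rw [h] at hsucc ⊢
    · rw [hsucc] at ih'
      simp only [Units.val_one] at ih' hsucc
      by_cases hs : Even (s : ℤ) <;>
        simp [-Int.even_coe_nat, tauFrom, gamma, edgeLetter, hpar, hs, ih', hsucc]
    · rw [hsucc] at ih'
      simp only [Units.val_neg, Units.val_one, ← sub_eq_add_neg] at ih' hsucc
      by_cases hs : Even (s : ℤ) <;>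
        simp [-Int.even_coe_nat, tauFrom, gamma, edgeLetter, hpar, hs, ih', hsucc, FreeGroup.invRev]

theorem R0_eq_edgeWord (p : ℕ) (q : ℤ) : R0 p q = edgeWord (height p q) 1 0 (2 * p) := by
  have := tauFrom_map_range' p q (2 * p) 0
  rw [Nat.cast_zero, height_zero, ← List.range_eq_range'] at this
  rw [← this, R0, tau, relator]
  congr 1
  simp [← List.flatMap_pure_eq_map, List.flatMap_assoc]
  rfl

end Relator

/-! ### Location of the maxima, and extraction of a root -/

section Step

variable {p p₁ x C : ℕ} {q q₁ y : ℤ}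

/-- Modulo `2 p`, the maxima of the height lie in `[1, x]`: translation by `x` goes up from
`[p + 1, 2 p]`, and translation by `-x` goes up from `[x + 1, p]`. -/
theorem le_of_height_eq_of_isGreatest (hp : 0 < p) (hq : Odd q) (hpq : IsCoprime (p : ℤ) q)
    (hy : Even y) (hxy : p * y - q * x = 1) {T : ℤ}
    (hT : IsGreatest (Set.range (height p q)) T) {i : ℤ} (hi : height p q i = T)
    (h2 : i ≤ 2 * p) : i ≤ p ∧ i ≤ x := by
  have hip : i ≤ p := by
    by_contra! h
    have h3 := height_add_of_mem_right hp hq hpq hy hxy (i := i) (by omega) h2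
    have h4 := hT.2 ⟨i + x, rfl⟩
    omega
  refine ⟨hip, ?_⟩
  by_contra! h
  have h3 := height_add_of_mem_left hp hq hpq hy hxy (i := i - x) (by omega) (by omega)
  have h4 := hT.2 ⟨i - x, rfl⟩
  rw [sub_add_cancel] at h3
  omega

theorem exists_le_of_isGreatest (hp : 0 < p) (hq : Odd q) (hpq : IsCoprime (p : ℤ) q)
    (hy : Even y) (hxy : p * y - q * x = 1) {T : ℤ}
    (hT : IsGreatest (Set.range (height p q)) T) :
    ∃ i : ℤ, 1 ≤ i ∧ i ≤ p ∧ i ≤ x ∧ height p q i = T := by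
  obtain ⟨j, hj⟩ := hT.1
  have hpos : (0 : ℤ) < 2 * p := by positivity
  have h1 := Int.emod_nonneg (j - 1) hpos.ne'
  have h2 := Int.emod_lt_of_pos (j - 1) hpos
  have h3 : height p q ((j - 1) % (2 * p) + 1) = T := by
    rw [← add_mul_period (height_add_two_period hp hq) ((j - 1) / (2 * p)), add_right_comm,
      Int.emod_add_mul_ediv, sub_add_cancel, hj]
  obtain ⟨h4, h5⟩ := le_of_height_eq_of_isGreatest hp hq hpq hy hxy hT h3 (by omega)
  exact ⟨_, by omega, h4, h5, h3⟩

theorem height_eq_of_le (hp₁ : 0 < p₁) (hp : p = C * x + p₁)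
    (hq : q = C * y + q₁) (hxy : p₁ * y - q₁ * x = 1) {i : ℤ} (h0 : 0 ≤ i) (hx : i ≤ x + 1) :
    height p q i = height p₁ q₁ i := by
  induction i, h0 using Int.leInduction with
  | base => rw [height_zero, height_zero]
  | succ i hi ih =>
    rw [height_succ, height_succ, ih (by omega),
      epsilon_eq_of_le hp₁ hp hq hxy hi (by omega)]

/-- The edges `0, …, x` of the path of `(p, q)` carry all its letters of top level, and they are also
the first edges of the `2 p₁`-periodic path of `(p₁, q₁)`. They are completed to `x / (2 p₁) + 1` full
periods of the latter without using further letters of top level. -/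
theorem exists_mk_edgeWord_eq_pow_mul (hp₁ : 0 < p₁) (hC : 0 < C) (hpx : p = C * x + p₁)
    (hqy : q = C * y + q₁) (hy : Even y) (hxy : p * y - q * x = 1) (hxy₁ : p₁ * y - q₁ * x = 1)
    (hq : Odd q) (hq₁ : Odd q₁) (hpq : IsCoprime (p : ℤ) q) (hpq₁ : IsCoprime (p₁ : ℤ) q₁) {T : ℤ}
    (hT : IsGreatest (Set.range (height p q)) T) (hT₁ : IsGreatest (Set.range (height p₁ q₁)) T)
    (e : ℤ) : ∃ V : Word ℤ, ¬ Appears (T - 1) V ∧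
      FreeGroup.mk (edgeWord (height p q) e 0 (2 * p)) =
        FreeGroup.mk (edgeWord (height p₁ q₁) e 0 (2 * p₁)) ^ (x / (2 * p₁) + 1) *
          FreeGroup.mk V := by
  have hp : 0 < p := by omega
  have hxp : x + 1 ≤ 2 * p := by nlinarith
  set n := x / (2 * p₁) with hn
  have hn1 : n * (2 * p₁) ≤ x := Nat.div_mul_le_self _ _
  have hn2 : x < (n + 1) * (2 * p₁) := by
    rw [add_mul, one_mul]
    exact Nat.lt_div_mul_add (by omega)
  have hP₁ := height_add_two_period hp₁ hq₁
  have hsplit : edgeWord (height p q) e 0 (2 * p) = edgeWord (height p₁ q₁) e 0 (x + 1) ++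
      edgeWord (height p q) e (x + 1) (2 * p - (x + 1)) := by
    conv_lhs => rw [show 2 * p = (x + 1) + (2 * p - (x + 1)) by omega, edgeWord_add]
    congr 1
    · refine edgeWord_congr fun i h1 h2 => height_eq_of_le hp₁ hpx hqy hxy₁ h1 ?_
      push_cast at h2
      omega
    · push_cast
      rw [zero_add]
  have hsplit₁ : edgeWord (height p₁ q₁) e 0 ((n + 1) * (2 * p₁)) =
      edgeWord (height p₁ q₁) e 0 (x + 1) ++
        edgeWord (height p₁ q₁) e (x + 1) ((n + 1) * (2 * p₁) - (x + 1)) := by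
    conv_lhs => rw [show (n + 1) * (2 * p₁) = (x + 1) + ((n + 1) * (2 * p₁) - (x + 1)) by omega,
      edgeWord_add]
    push_cast
    rw [zero_add]
  refine ⟨FreeGroup.invRev (edgeWord (height p₁ q₁) e (x + 1) ((n + 1) * (2 * p₁) - (x + 1))) ++
    edgeWord (height p q) e (x + 1) (2 * p - (x + 1)), ?_, ?_⟩
  · rw [appears_append, appears_invRev]
    rintro (h | h)
    · obtain ⟨i, h1, h2, -, h3⟩ := appears_edgeWord.mp h
      replace h2 : i < ((n + 1) * (2 * p₁) : ℕ) := by omega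
      push_cast at h2
      have htop : ∃ j : ℤ, x + 1 ≤ j ∧ j ≤ (n + 1) * (2 * (p₁ : ℤ)) ∧ height p₁ q₁ j = T := by
        rcases height_step p₁ q₁ i with h4 | h4
        · exact ⟨i + 1, by omega, by omega, by omega⟩
        · exact ⟨i, by omega, by omega, by omega⟩
      obtain ⟨j, hj1, hj2, hj3⟩ := htop
      have hn1' : n * (2 * (p₁ : ℤ)) ≤ x := by exact_mod_cast hn1
      -- A maximum beyond `x` in the last period would lie in the first half of that period, and then
      -- its translate by `-x` would be higher still.
      have hj4 : height p₁ q₁ (j - n * (2 * p₁)) = T := by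
        rw [← add_mul_period hP₁ n, ← hj3]
        congr 1
        ring
      have hj5 := (le_of_height_eq_of_isGreatest hp₁ hq₁ hpq₁ hy hxy₁ hT₁ hj4 (by linarith)).1
      have hj6 := height_add_of_mem_left hp₁ hq₁ hpq₁ hy hxy₁ (i := j - x) (by omega) (by omega)
      have hj7 := hT₁.2 ⟨j - x, rfl⟩
      rw [sub_add_cancel] at hj6
      omega
    · obtain ⟨i, h1, h2, -, h3⟩ := appears_edgeWord.mp h
      push_cast [hxp] at h2
      have htop : ∃ j : ℤ, x + 1 ≤ j ∧ j ≤ 2 * (p : ℤ) ∧ height p q j = T := by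
        rcases height_step p q i with h4 | h4
        · exact ⟨i + 1, by omega, by omega, by omega⟩
        · exact ⟨i, by omega, by omega, by omega⟩
      obtain ⟨j, hj1, hj2, hj3⟩ := htop
      have := (le_of_height_eq_of_isGreatest hp hq hpq hy hxy hT hj3 hj2).2
      omega
  · rw [← mk_edgeWord_mul_period hP₁, hsplit, hsplit₁, ← FreeGroup.mul_mk, ← FreeGroup.mul_mk,
      ← FreeGroup.mul_mk, ← FreeGroup.inv_mk]
    group

end Step

/-- A Bézout relation modulo `2 p`, which is what forces `y` to be even. -/
theorem exists_even_mul_sub_mul_eq_one {p q : ℤ} (hp : 2 ≤ p) (hq : Odd q) (hpq : IsCoprime p q) :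
    ∃ x y : ℤ, Even y ∧ x ≠ 0 ∧ |x| < p ∧ p * y - q * x = 1 := by
  have h2 : IsCoprime (2 * p) q := by
    refine IsCoprime.mul_left ?_ hpq
    obtain ⟨k, rfl⟩ := hq
    exact ⟨-k, 1, by ring⟩
  obtain ⟨a, b, hab⟩ := h2
  have h1 := Int.emod_add_mul_ediv (-b) (2 * p)
  have hl := Int.emod_nonneg (-b) (by omega : 2 * p ≠ 0)
  have hu := Int.emod_lt_of_pos (-b) (by omega : 0 < 2 * p)
  generalize (-b) % (2 * p) = x at *
  generalize (-b) / (2 * p) = k at *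
  have hx : p * (2 * (a - k * q)) - q * x = 1 := by
    obtain rfl : b = -(x + 2 * p * k) := by linarith
    linarith
  have hnd : ¬ p ∣ x := fun ⟨c, hc⟩ => by
    have := Int.le_of_dvd one_pos (⟨2 * (a - k * q) - q * c, by rw [← hx, hc]; ring⟩ : p ∣ 1)
    omega
  have h0 : x ≠ 0 := fun h => hnd (h ▸ dvd_zero p)
  have hxp : x ≠ p := fun h => hnd (h ▸ dvd_refl p)
  rcases lt_or_gt_of_ne hxp with h | h
  · exact ⟨x, 2 * (a - k * q), even_two_mul _, h0, by rw [abs_lt]; omega, hx⟩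
  · exact ⟨x - 2 * p, 2 * (a - k * q - q), even_two_mul _, by omega, by rw [abs_lt]; omega,
      by rw [← hx]; ring⟩

theorem edgeWord_height_one {q : ℤ} (hq : Odd q) {T : ℤ}
    (hT : IsGreatest (Set.range (height 1 q)) T) (e : ℤ) :
    edgeWord (height 1 q) e 0 2 = [(T - 1, true)] ∨
      edgeWord (height 1 q) e 0 2 = [(T - 1, false)] := by
  have h0 := height_zero 1 q
  have h1 := height_succ 1 q 0
  rw [epsilon_zero, h0] at h1
  have h2 := height_add_period one_pos hq
  push_cast at h1 h2
  have hall := eq_of_succ_eq (f := fun i => height 1 q i * (1 - height 1 q i)) fun i => by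
    rw [h2, show height 1 q 1 = 1 from h1]
    ring
  have hT1 : T = 1 := by
    apply le_antisymm
    · obtain ⟨i, rfl⟩ := hT.1
      have := hall i
      rw [h0] at this
      nlinarith
    · exact hT.2 ⟨1, h1⟩
  have h3 : height 1 q 2 = 0 := by
    have := h2 1
    rw [show height 1 q 1 = 1 from h1] at this
    simpa using this
  have h4 : height 1 q 1 = 1 := h1
  subst hT1
  by_cases he : Even e
  · left
    simp [edgeWord, List.range_succ, edgeLetter, he, h0, h4, Int.even_add]
  · right
    simp [edgeWord, List.range_succ, edgeLetter, he, h3, h4, Int.even_add]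

/-! ### Existence of chains -/

theorem exists_rootChain_neg {p : ℕ} {q : ℤ} (hp : 0 < p) (hq : Odd q) {ns : List ℕ} (hns : ns ≠ [])
    (H : ∀ T, IsGreatest (Set.range (height p (-q))) T → ∀ e,
      RootChain (T - 1) (TopSymmetric (height p (-q) p - T) (T - 1)) ns
        (edgeWord (height p (-q)) e 0 (2 * p)))
    {T : ℤ} (hT : IsGreatest (Set.range (height p q)) T) (e : ℤ) :
    RootChain (T - 1) (TopSymmetric (height p q p - T) (T - 1)) ns
      (edgeWord (height p q) e 0 (2 * p)) := by
  have hh : ∀ i, height p q i = height p (-q) (p + 1 - i) + -height p (-q) (p + 1) := by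
    intro i
    simpa only [neg_neg] using height_neg hp hq.neg i
  have hP := height_add_two_period hp hq.neg
  have hT' : IsGreatest (Set.range (height p (-q))) (T + height p (-q) (p + 1)) := by
    constructor
    · obtain ⟨i, hi⟩ := hT.1
      exact ⟨p + 1 - i, by rw [← hi, hh]; ring⟩
    · rintro _ ⟨i, rfl⟩
      have h1 := hT.2 ⟨p + 1 - i, rfl⟩
      rw [hh, sub_sub_cancel] at h1
      linarith
  have h1 : IsConj
      (FreeGroup.mk (edgeWord (height p (-q)) (e + p) ((p + 1 : ℕ) : ℤ) (2 * p)))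
      (FreeGroup.mk (edgeWord (height p (-q)) (e + p) 0 (2 * p))) :=
    (isConj_mk_edgeWord_rotate hP (e + p) (by omega)).symm
  have h2 := ((H _ hT' (e + p)).of_isConj hns h1).reflect (t := -height p (-q) (p + 1))
  have h3 : edgeWord (height p q) e 0 (2 * p) = shiftWord (-height p (-q) (p + 1))
      (FreeGroup.invRev (edgeWord (height p (-q)) (e + p) ((p + 1 : ℕ) : ℤ) (2 * p))) := by
    rw [edgeWord_reflect (height_step p (-q)) hh, ← edgeWord_add_period hP]
    congr 3
    push_cast
    ring
  have h4 := hh p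
  have h5 := height_add_period hp hq.neg 1
  rw [add_sub_cancel_left] at h4
  rw [add_comm 1 (p : ℤ)] at h5
  rw [h3]
  convert h2 using 2 <;> linarith

/-- The exponents do not depend on the parity `e`, so that the chain for parity `e + p`, reflected by
translation by `p`, serves at the bottom. -/
theorem exists_rootChain (p : ℕ) (hp : 0 < p) (q : ℤ) (hq : Odd q) (hpq : IsCoprime (p : ℤ) q) :
    ∃ ns : List ℕ, (2 ≤ p → ns ≠ []) ∧ ∀ T, IsGreatest (Set.range (height p q)) T → ∀ e,
      RootChain (T - 1) (TopSymmetric (height p q p - T) (T - 1)) ns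
        (edgeWord (height p q) e 0 (2 * p)) := by
  induction p using Nat.strong_induction_on generalizing q with
  | _ p ih =>
  rcases (by omega : p = 1 ∨ 2 ≤ p) with rfl | hp2
  · exact ⟨[], by omega, fun T hT e => edgeWord_height_one hq hT e⟩
  obtain ⟨x, y, hy, hx0, hxp, hxy⟩ := exists_even_mul_sub_mul_eq_one (by exact_mod_cast hp2) hq hpq
  -- It suffices to treat `x > 0`, since `(x, q)` may be replaced by `(-x, -q)`.
  suffices key : ∀ (q : ℤ) (x : ℕ), Odd q → IsCoprime (p : ℤ) q → 0 < x → x < p →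
      p * y - q * x = 1 → ∃ ns : List ℕ, ns ≠ [] ∧
        ∀ T, IsGreatest (Set.range (height p q)) T → ∀ e,
          RootChain (T - 1) (TopSymmetric (height p q p - T) (T - 1)) ns
            (edgeWord (height p q) e 0 (2 * p)) by
    rw [abs_lt] at hxp
    rcases lt_or_gt_of_ne hx0 with hx | hx
    · obtain ⟨ns, h1, h2⟩ := key (-q) (-x).toNat hq.neg hpq.neg_right (by omega) (by omega) (by
        rw [Int.toNat_of_nonneg (by omega), ← hxy]; ring)
      exact ⟨ns, fun _ => h1, fun T hT e => exists_rootChain_neg hp hq h1 h2 hT e⟩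
    · obtain ⟨ns, h1, h2⟩ := key q x.toNat hq hpq (by omega) (by omega) (by
        rw [Int.toNat_of_nonneg (by omega), ← hxy])
      exact ⟨ns, fun _ => h1, h2⟩
  clear! x q
  intro q x hq hpq hx0 hxp hxy
  obtain ⟨C, p₁, hC, hp₁, hp₁x, hpx⟩ : ∃ C p₁ : ℕ, 0 < C ∧ 0 < p₁ ∧ p₁ ≤ x ∧ p = C * x + p₁ :=
    ⟨(p - 1) / x, (p - 1) % x + 1, Nat.div_pos (by omega) hx0, by omega, Nat.mod_lt _ hx0, by
      have := Nat.div_add_mod' (p - 1) x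
      omega⟩
  obtain ⟨q₁, hqy⟩ : ∃ q₁, q = C * y + q₁ := ⟨q - C * y, by ring⟩
  have hq₁ : Odd q₁ := by
    rw [show q₁ = q - C * y by rw [hqy]; ring]
    exact hq.sub_even (hy.mul_left _)
  have hxy₁ : p₁ * y - q₁ * x = 1 := by
    rw [← hxy, hqy, hpx]
    push_cast
    ring
  have hpq₁ : IsCoprime (p₁ : ℤ) q₁ := ⟨y, -x, by rw [← hxy₁]; ring⟩
  obtain ⟨ns, -, hns⟩ := ih p₁ (by nlinarith) hp₁ q₁ hq₁ hpq₁
  refine ⟨(x / (2 * p₁) + 1) :: ns, by simp, fun T hT e => ?_⟩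
  have heq : ∀ {i : ℤ}, 0 ≤ i → i ≤ x → height p q i = height p₁ q₁ i := fun h0 h1 =>
    height_eq_of_le hp₁ hpx hqy hxy₁ h0 (by omega)
  -- Both heights attain their maxima at vertices in `[1, x]`, where they agree.
  have hT₁ : IsGreatest (Set.range (height p₁ q₁)) T := by
    obtain ⟨T₁, hT₁⟩ := exists_isGreatest_range hp₁ (height_add_two_period hp₁ hq₁)
    obtain ⟨i, hi1, -, hi2, hi3⟩ := exists_le_of_isGreatest hp hq hpq hy hxy hT
    obtain ⟨j, hj1, -, hj2, hj3⟩ := exists_le_of_isGreatest hp₁ hq₁ hpq₁ hy hxy₁ hT₁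
    have h1 := hT.2 ⟨j, rfl⟩
    have h2 := hT₁.2 ⟨i, rfl⟩
    rw [heq (by omega) (by omega)] at hi3 h1
    rwa [show T = T₁ by omega]
  -- Hence the lowest level, `height p - T`, drops by `C > 0`.
  have hlow : height p q p = height p₁ q₁ p₁ - C := by
    have hdesc : ∀ n : ℕ, n ≤ C → height p q (p₁ + n * x) = height p q p₁ - n := by
      intro n hn
      induction n with
      | zero => simp
      | succ n ihn =>
        have hle : p₁ + n * x ≤ p := by
          rw [hpx]
          nlinarith
        have h1 := height_add_of_mem_left hp hq hpq hy hxy (i := p₁ + n * x)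
          (by have : (0 : ℤ) ≤ n * x := by positivity
              omega) (by exact_mod_cast hle)
        push_cast
        rw [show (p₁ : ℤ) + (n + 1) * x = p₁ + n * x + x by ring, h1, ihn (by omega)]
        ring
    rw [← heq (by omega) (by omega), ← hdesc C le_rfl, hpx]
    congr 1
    push_cast
    ring
  obtain ⟨V, hV, hmk⟩ := exists_mk_edgeWord_eq_pow_mul hp₁ hC hpx hqy hy hxy hxy₁ hq hq₁ hpq hpq₁
    hT hT₁ e
  refine ⟨Nat.succ_pos _, edgeWord (height p₁ q₁) e 0 (2 * p₁), V, by rw [hmk], hV,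
    topSymmetric_edgeWord hp₁ hq₁ hT₁ (by omega) e, (hns T hT₁ e).mono ?_⟩
  rintro A ⟨l, h1, h2⟩
  exact ⟨l, by omega, h2⟩

end TwoBridge

theorem lemma4p4 (p : ℕ) (q : ℤ) (hq : Odd q) (hqp : |q| < (p : ℤ)) (hpq : IsCoprime (p : ℤ) q)
    (M m : ℤ)
    (hM : IsGreatest {k : ℤ | TwoBridge.Appears k (TwoBridge.R0 p q)} M)
    (hm : IsLeast {k : ℤ | TwoBridge.Appears k (TwoBridge.R0 p q)} m) :
    ∃ (N : ℕ) (n : ℕ → ℕ), 0 < N ∧ (∀ i ∈ Finset.Icc 1 N, 0 < n i) ∧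
      (∃ A V : ℕ → TwoBridge.Word ℤ,
        A 0 = TwoBridge.R0 p q ∧
        (A N = [(M, true)] ∨ A N = [(M, false)]) ∧
        (∀ i ∈ Finset.Icc 1 N,
          IsConj (FreeGroup.mk (A (i - 1))) (FreeGroup.mk (A i) ^ n i * FreeGroup.mk (V i))) ∧
        (∀ i ∈ Finset.Icc 1 N, ¬ TwoBridge.Appears M (V i)) ∧
        (∀ i ∈ Finset.Icc 1 N, ∃ l : ℤ, m < l ∧ l ≤ M ∧ ∃ b : ℤ → ℤ,
          TwoBridge.abClass (A i) = ∑ j ∈ Finset.Icc l M, b j • Finsupp.single j (1 : ℤ) ∧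
          ∀ j : ℤ, 0 ≤ j → j ≤ M - l → |b (l + j)| = |b (M - j)|)) ∧
      (∃ A V : ℕ → TwoBridge.Word ℤ,
        A 0 = TwoBridge.R0 p q ∧
        (A N = [(m, true)] ∨ A N = [(m, false)]) ∧
        (∀ i ∈ Finset.Icc 1 N,
          IsConj (FreeGroup.mk (A (i - 1))) (FreeGroup.mk (A i) ^ n i * FreeGroup.mk (V i))) ∧
        (∀ i ∈ Finset.Icc 1 N, ¬ TwoBridge.Appears m (V i)) ∧
        (∀ i ∈ Finset.Icc 1 N, ∃ l : ℤ, m ≤ l ∧ l < M ∧ ∃ b : ℤ → ℤ,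
          TwoBridge.abClass (A i) = ∑ j ∈ Finset.Icc m l, b j • Finsupp.single j (1 : ℤ) ∧
          ∀ j : ℤ, 0 ≤ j → j ≤ l - m → |b (m + j)| = |b (l - j)|)) := by
  open TwoBridge in
  have hp2 : 2 ≤ p := by
    obtain ⟨k, hk⟩ := hq
    rw [abs_lt] at hqp
    omega
  have hp : 0 < p := by omega
  have hP := height_add_two_period hp hq
  obtain ⟨T, hT⟩ := exists_isGreatest_range hp hP
  rw [R0_eq_edgeWord] at hM hm ⊢
  obtain rfl := hM.unique (isGreatest_appears_edgeWord hp hq hT 1)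
  obtain rfl := hm.unique (isLeast_appears_edgeWord hp hq hT 1)
  obtain ⟨ns, hns, H⟩ := exists_rootChain p hp q hq hpq
  have hbot := (H T hT (1 + p)).flip (c := height p q p - 1) (by ring)
  rw [← edgeWord_flip (height_step p q) (height_add_period hp hq)] at hbot
  replace hbot := hbot.of_isConj (hns hp2) (isConj_mk_edgeWord_rotate hP 1 (by omega))
  obtain ⟨A, V, hA0, hAN, hA⟩ := (H T hT 1).exists_sequences
  obtain ⟨B, W, hB0, hBN, hB⟩ := hbot.exists_sequences
  exact ⟨ns.length, fun i => ns.getD (i - 1) 0, List.length_pos_iff.mpr (hns hp2),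
    fun i hi => (hA i hi).1,
    ⟨A, V, hA0, hAN, fun i hi => (hA i hi).2.1, fun i hi => (hA i hi).2.2.1,
      fun i hi => (hA i hi).2.2.2.exists_coeff⟩,
    ⟨B, W, hB0, hBN, fun i hi => (hB i hi).2.1, fun i hi => (hB i hi).2.2.1,
      fun i hi => (hB i hi).2.2.2.exists_coeff⟩⟩
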